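/- Let $\mathscr{M}=(\underline{M},\otimes,I)$ be a symmetric monoidal closed category whose underlying category is locally presentable. Let $\Phi_{\mathrm{epi}}$ be the category whose objects are the sets $\mathbf n=\{0,\dots,n-1\}$, $n\ge 0$, and whose morphisms are the surjections; it is symmetric monoidal under disjoint union $+$, with unit $\mathbf 0=\emptyset$. Let $\Phi_{\mathrm{epi},+}$ be its full subcategory of nonempty sets. A *commutative co-Segal premonoid* of $\mathscr{M}$ is a symmetric monoidal lax functor $\mathcal F:(\Phi_{\mathrm{epi}}^{\mathrm{op}},+,\mathbf 0)\to\mathscr{M}$, with laxity maps $\varphi:\mathcal F(\mathbf n)\otimes\mathcal F(\mathbf m)\to\mathcal F(\mathbf n+\mathbf m)$, whose unit map $I\to\mathcal F(\mathbf 0)$ is an isomorphism, together with a map $e:I\to\mathcal F(\mathbf 1)$ such that the composite $$I\otimes\mathcal F(\mathbf 1)\xrightarrow{e\otimes\mathrm{id}}\mathcal F(\mathbf 1)\otimes\mathcal F(\mathbf 1)\xrightarrow{\varphi}\mathcal F(\mathbf 2)$$ equals $I\otimes\mathcal F(\mathbf 1)\cong\mathcal F(\mathbf 1)\to\mathcal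 F(\mathbf 2)$, where the last map is induced by the unique surjection $\mathbf 2\to\mathbf 1$. A morphism of premonoids is a natural transformation that is compatible with the laxity maps, with the isomorphisms $I\cong\mathcal F(\mathbf 0)$ and with the maps $e$. Let $\mathsf{Com}_{\mathbf S}(\mathscr{M})$ be the category of commutative co-Segal premonoids of $\mathscr{M}$, and let $$\mathcal U:\mathsf{Com}_{\mathbf S}(\mathscr{M})\to\mathrm{Hom}(\Phi_{\mathrm{epi},+}^{\mathrm{op}},\mathscr{M})$$ be the forgetful functor, which sends $\mathcal F$ to the restriction of its underlying functor to nonempty sets. Then $\mathcal U$ has a left adjoint $\Gamma$, the adjunction $\Gamma\dashv\mathcal U$ is monadic (that is, the comparison functor from $\mathsf{Com}_{\mathbf S}(\mathscr{M})$ to the category of algebras of the monad $\mathcal U\Gamma$ is an equivalence of categories), and $\mathsf{Com}_{\mathbf S}(\mathscr{M})$ is locally presentable. -/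

import Mathlib

open CategoryTheory MonoidalCategory Opposite

/-! ### The symmetric monoidal category of finite sets `{0, …, n-1}` and surjections -/

/-- The objects are the sets `Fin n = {0, …, n-1}`, for all natural numbers `n` (`0` included). -/
structure PhiEpi : Type where
  /-- the number of elements -/
  n : ℕ

namespace PhiEpi

/-- A morphism is a surjective function. -/
@[ext]
structure Hom (X Y : PhiEpi) : Type where
  /-- the underlying function -/
  toFun : Fin X.n → Fin Y.n
  surj : Function.Surjective toFun

instance : Category PhiEpi where
  Hom := Hom
  id X := ⟨id, Function.surjective_id⟩
  comp f g := ⟨g.toFun ∘ f.toFun, g.surj.comp f.surj⟩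

@[ext]
theorem hom_ext {X Y : PhiEpi} {f g : X ⟶ Y} (h : ∀ i, f.toFun i = g.toFun i) : f = g :=
  Hom.ext (funext h)

@[simp] theorem id_toFun (X : PhiEpi) (i : Fin X.n) : Hom.toFun (𝟙 X) i = i := rfl

@[simp] theorem comp_toFun {X Y Z : PhiEpi} (f : X ⟶ Y) (g : Y ⟶ Z) (i : Fin X.n) :
    Hom.toFun (f ≫ g) i = g.toFun (f.toFun i) := rfl

/-- A bijection, regarded as an isomorphism. -/
@[simps]
def isoOfEquiv {X Y : PhiEpi} (e : Fin X.n ≃ Fin Y.n) : X ≅ Y where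
  hom := ⟨e, e.surjective⟩
  inv := ⟨e.symm, e.symm.surjective⟩

/-- The disjoint union `Fin (a + b)` of `Fin a` and `Fin b`. -/
abbrev add (X Y : PhiEpi) : PhiEpi := ⟨X.n + Y.n⟩

/-- The disjoint union of two surjections. -/
def addMap {X Y X' Y' : PhiEpi} (f : X ⟶ Y) (g : X' ⟶ Y') : add X X' ⟶ add Y Y' where
  toFun := Fin.addCases (fun i => Fin.castAdd Y'.n (f.toFun i))
    (fun j => Fin.natAdd Y.n (g.toFun j))
  surj := by
    intro k
    induction k using Fin.addCases with
    | left i =>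
      obtain ⟨a, rfl⟩ := f.surj i
      exact ⟨Fin.castAdd X'.n a, by simp⟩
    | right j =>
      obtain ⟨b, rfl⟩ := g.surj j
      exact ⟨Fin.natAdd X.n b, by simp⟩

@[simp] theorem addMap_castAdd {X Y X' Y' : PhiEpi} (f : X ⟶ Y) (g : X' ⟶ Y') (i : Fin X.n) :
    (addMap f g).toFun (Fin.castAdd X'.n i) = Fin.castAdd Y'.n (f.toFun i) := by
  simp [addMap]

@[simp] theorem addMap_natAdd {X Y X' Y' : PhiEpi} (f : X ⟶ Y) (g : X' ⟶ Y') (j : Fin X'.n) :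
    (addMap f g).toFun (Fin.natAdd X.n j) = Fin.natAdd Y.n (g.toFun j) := by
  simp [addMap]

instance : MonoidalCategoryStruct PhiEpi where
  tensorObj := add
  whiskerLeft X _ _ f := addMap (𝟙 X) f
  whiskerRight f Y := addMap f (𝟙 Y)
  tensorHom := addMap
  tensorUnit := ⟨0⟩
  associator X Y Z := isoOfEquiv (finCongr (Nat.add_assoc X.n Y.n Z.n))
  leftUnitor X := isoOfEquiv (finCongr (Nat.zero_add X.n))
  rightUnitor X := isoOfEquiv (finCongr (Nat.add_zero X.n))

end PhiEpi

namespace PhiEpi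

theorem addMap_id (X Y : PhiEpi) : addMap (𝟙 X) (𝟙 Y) = 𝟙 (add X Y) := by
  ext k
  induction k using Fin.addCases <;> simp

theorem addMap_comp {X Y Z X' Y' Z' : PhiEpi} (f : X ⟶ Y) (g : Y ⟶ Z) (f' : X' ⟶ Y')
    (g' : Y' ⟶ Z') : addMap (f ≫ g) (f' ≫ g') = addMap f f' ≫ addMap g g' := by
  ext k
  induction k using Fin.addCases <;> simp

theorem add_hom_ext {X Y Z : PhiEpi} {f g : add X Y ⟶ Z}
    (h : ∀ i, f.toFun (Fin.castAdd Y.n i) = g.toFun (Fin.castAdd Y.n i))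
    (h' : ∀ i, f.toFun (Fin.natAdd X.n i) = g.toFun (Fin.natAdd X.n i)) : f = g := by
  apply hom_ext
  intro k
  induction k using Fin.addCases with
  | left i => exact h i
  | right i => exact h' i

theorem add_add_hom_ext {X Y Z W : PhiEpi} {f g : add (add X Y) Z ⟶ W}
    (h : ∀ i, f.toFun (Fin.castAdd Z.n (Fin.castAdd Y.n i)) =
      g.toFun (Fin.castAdd Z.n (Fin.castAdd Y.n i)))
    (h' : ∀ i, f.toFun (Fin.castAdd Z.n (Fin.natAdd X.n i)) =
      g.toFun (Fin.castAdd Z.n (Fin.natAdd X.n i)))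
    (h'' : ∀ i, f.toFun (Fin.natAdd (X.n + Y.n) i) = g.toFun (Fin.natAdd (X.n + Y.n) i)) :
    f = g := by
  refine add_hom_ext (fun i => ?_) h''
  induction i using Fin.addCases with
  | left i => exact h i
  | right i => exact h' i

theorem assoc_left (X Y Z : PhiEpi) (i : Fin X.n) :
    (α_ X Y Z).hom.toFun (Fin.castAdd Z.n (Fin.castAdd Y.n i)) = Fin.castAdd (Y.n + Z.n) i := rfl

theorem assoc_mid (X Y Z : PhiEpi) (i : Fin Y.n) :
    (α_ X Y Z).hom.toFun (Fin.castAdd Z.n (Fin.natAdd X.n i)) =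
      Fin.natAdd X.n (Fin.castAdd Z.n i) := rfl

theorem assoc_right (X Y Z : PhiEpi) (i : Fin Z.n) :
    (α_ X Y Z).hom.toFun (Fin.natAdd (X.n + Y.n) i) = Fin.natAdd X.n (Fin.natAdd Y.n i) :=
  Fin.ext (Nat.add_assoc _ _ _)

theorem leftUnitor_natAdd (X : PhiEpi) (i : Fin X.n) :
    (λ_ X).hom.toFun (Fin.natAdd 0 i) = i := Fin.ext (Nat.zero_add _)

theorem rightUnitor_castAdd (X : PhiEpi) (i : Fin X.n) :
    (ρ_ X).hom.toFun (Fin.castAdd 0 i) = i := rfl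

theorem whiskerLeft_eq (X : PhiEpi) {Y Z : PhiEpi} (f : Y ⟶ Z) : X ◁ f = addMap (𝟙 X) f := rfl

theorem whiskerRight_eq {X Y : PhiEpi} (f : X ⟶ Y) (Z : PhiEpi) : f ▷ Z = addMap f (𝟙 Z) := rfl

theorem tensorHom_eq {X Y X' Y' : PhiEpi} (f : X ⟶ Y) (g : X' ⟶ Y') : f ⊗ₘ g = addMap f g := rfl

theorem addMap_val {X Y X' Y' : PhiEpi} (f : X ⟶ Y) (g : X' ⟶ Y') (h : X.n = Y.n)
    (hf : ∀ i, (f.toFun i).val = i.val) (hg : ∀ i, (g.toFun i).val = i.val)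
    (k : Fin (X.n + X'.n)) : ((addMap f g).toFun k).val = k.val := by
  induction k using Fin.addCases with
  | left i => simp [hf]
  | right i => rw [addMap_natAdd, Fin.val_natAdd, Fin.val_natAdd, hg, h]

instance : MonoidalCategory PhiEpi where
  tensorHom_def f g := by
    change addMap f g = addMap f (𝟙 _) ≫ addMap (𝟙 _) g
    rw [← addMap_comp, Category.comp_id, Category.id_comp]
  id_tensorHom_id := addMap_id
  tensorHom_comp_tensorHom f g f' g' := (addMap_comp f f' g g').symm
  whiskerLeft_id := addMap_id
  id_whiskerRight := addMap_id
  associator_naturality f g h := by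
    simp only [tensorHom_eq]
    apply add_add_hom_ext <;> intro i
    · erw [comp_toFun, comp_toFun, addMap_castAdd, addMap_castAdd, assoc_left, assoc_left,
        addMap_castAdd]
      rfl
    · erw [comp_toFun, comp_toFun, addMap_castAdd, addMap_natAdd, assoc_mid, assoc_mid,
        addMap_natAdd, addMap_castAdd]
    · erw [comp_toFun, comp_toFun, addMap_natAdd, assoc_right, assoc_right,
        addMap_natAdd, addMap_natAdd]
  leftUnitor_naturality f := by
    rw [whiskerLeft_eq]
    refine add_hom_ext (fun i => i.elim0) (fun i => ?_)
    erw [comp_toFun, comp_toFun, addMap_natAdd, leftUnitor_natAdd, leftUnitor_natAdd]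
  rightUnitor_naturality f := by
    rw [whiskerRight_eq]
    refine add_hom_ext (fun i => ?_) (fun i => i.elim0)
    erw [comp_toFun, comp_toFun, addMap_castAdd, rightUnitor_castAdd, rightUnitor_castAdd]
  pentagon W X Y Z := by
    apply hom_ext
    intro i
    apply Fin.ext
    trans i.val
    · exact addMap_val (α_ W X Y).hom (𝟙 Z) (Nat.add_assoc _ _ _) (fun _ => rfl) (fun _ => rfl) i
        |> (addMap_val (𝟙 W) (α_ X Y Z).hom rfl (fun _ => rfl) (fun _ => rfl) _).trans
    · rfl
  triangle X Y := by
    apply hom_ext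
    intro i
    apply Fin.ext
    trans i.val
    · exact addMap_val (𝟙 X) (λ_ Y).hom rfl (fun _ => rfl) (fun _ => rfl) _
    · exact (addMap_val (ρ_ X).hom (𝟙 Y) (Nat.add_zero _) (fun _ => rfl) (fun _ => rfl) i).symm

/-- The isomorphism that exchanges the two summands of a disjoint union. -/
def swap (X Y : PhiEpi) : add X Y ≅ add Y X := isoOfEquiv finAddFlip

theorem swap_castAdd (X Y : PhiEpi) (i : Fin X.n) :
    (swap X Y).hom.toFun (Fin.castAdd Y.n i) = Fin.natAdd Y.n i :=
  finAddFlip_apply_castAdd i Y.n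

theorem swap_natAdd (X Y : PhiEpi) (i : Fin Y.n) :
    (swap X Y).hom.toFun (Fin.natAdd X.n i) = Fin.castAdd X.n i :=
  finAddFlip_apply_natAdd i X.n

theorem swap_swap (X Y : PhiEpi) : (swap X Y).hom ≫ (swap Y X).hom = 𝟙 (add X Y) :=
  add_hom_ext (fun i => by rw [comp_toFun, swap_castAdd, swap_natAdd, id_toFun])
    (fun i => by rw [comp_toFun, swap_natAdd, swap_castAdd, id_toFun])

theorem swap_inv (X Y : PhiEpi) : (swap X Y).inv = (swap Y X).hom :=
  Iso.inv_ext (swap_swap X Y)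

theorem swap_natural {X Y X' Y' : PhiEpi} (f : X ⟶ Y) (g : X' ⟶ Y') :
    addMap f g ≫ (swap Y Y').hom = (swap X X').hom ≫ addMap g f :=
  add_hom_ext
    (fun i => by
      rw [comp_toFun, comp_toFun, addMap_castAdd, swap_castAdd, swap_castAdd, addMap_natAdd])
    (fun i => by
      rw [comp_toFun, comp_toFun, addMap_natAdd, swap_natAdd, swap_natAdd, addMap_castAdd])

theorem swap_hexagon (X Y Z : PhiEpi) :
    (α_ X Y Z).hom ≫ (swap X (Y ⊗ Z)).hom ≫ (α_ Y Z X).hom =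
      (swap X Y).hom ▷ Z ≫ (α_ Y X Z).hom ≫ Y ◁ (swap X Z).hom := by
  rw [whiskerLeft_eq, whiskerRight_eq]
  apply add_add_hom_ext <;> intro i <;> apply Fin.ext
  · erw [comp_toFun, comp_toFun, comp_toFun, comp_toFun, assoc_left, swap_castAdd, assoc_right,
      addMap_castAdd, swap_castAdd, assoc_mid, addMap_natAdd, swap_castAdd]
  · erw [comp_toFun, comp_toFun, comp_toFun, comp_toFun, assoc_mid, swap_natAdd, assoc_left,
      addMap_castAdd, swap_natAdd, assoc_left, addMap_castAdd]
    rfl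
  · erw [comp_toFun, comp_toFun, comp_toFun, comp_toFun, assoc_right, swap_natAdd, assoc_mid,
      addMap_natAdd, assoc_right, addMap_natAdd, swap_natAdd]
    rfl

instance : SymmetricCategory PhiEpi where
  braiding := swap
  braiding_naturality_right X _ _ f := swap_natural (𝟙 X) f
  braiding_naturality_left f Z := swap_natural f (𝟙 Z)
  hexagon_forward := swap_hexagon
  hexagon_reverse X Y Z := by
    have h : α_ Z X Y ≪≫ swap Z (X ⊗ Y) ≪≫ α_ X Y Z =
        whiskerRightIso (swap Z X) Y ≪≫ α_ X Z Y ≪≫ whiskerLeftIso X (swap Z Y) :=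
      Iso.ext (swap_hexagon Z X Y)
    simpa [swap_inv] using congrArg Iso.inv h
  symmetry := swap_swap

/-- The one-point set. -/
abbrev one : PhiEpi := ⟨1⟩

/-- The unique map from the two-point set, written as the disjoint union of two one-point sets,
to the one-point set. -/
def fold : one ⊗ one ⟶ one where
  toFun _ := 0
  surj _ := ⟨(0 : Fin 2), Subsingleton.elim _ _⟩

/-- The objects other than the empty set. -/
def nonempty : ObjectProperty PhiEpi := fun X => X.n ≠ 0

/-- The full subcategory of the nonempty sets. -/
abbrev Pos : Type := nonempty.FullSubcategory

end PhiEpi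

/-! ### Commutative co-Segal premonoids -/

universe w u

/-- A commutative co-Segal premonoid of `M`: a symmetric monoidal lax functor from
`(PhiEpiᵒᵖ, +, 0)` to `M` that is normal and weakly unital. -/
structure CoSegalPremonoid (M : Type u) [Category.{w} M] [MonoidalCategory M]
    [SymmetricCategory M] where
  /-- the underlying functor -/
  F : PhiEpiᵒᵖ ⥤ M
  /-- the symmetric lax structure -/
  lax : F.LaxBraided
  /-- Normality: `I ⟶ F(0)` is an isomorphism. By the unit axioms of a lax functor, the maps
  `F(0) ⊗ F(n) ⟶ F(n)` and `F(n) ⊗ F(0) ⟶ F(n)` are then isomorphisms too. -/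
  normal : IsIso (Functor.LaxMonoidal.ε F)
  /-- the weak unit -/
  e : 𝟙_ M ⟶ F.obj (op PhiEpi.one)
  /-- `I ⊗ F(1) ⟶ F(1) ⊗ F(1) ⟶ F(2)` agrees with `I ⊗ F(1) ≅ F(1) ⟶ F(2)`. -/
  weak_unit : e ▷ F.obj (op PhiEpi.one) ≫
      Functor.LaxMonoidal.μ F (op PhiEpi.one) (op PhiEpi.one) =
    (λ_ (F.obj (op PhiEpi.one))).hom ≫ F.map PhiEpi.fold.op

namespace CoSegalPremonoid

variable {M : Type u} [Category.{w} M] [MonoidalCategory M] [SymmetricCategory M]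

instance (A : CoSegalPremonoid M) : A.F.LaxBraided := A.lax

/-- A morphism of premonoids: a natural transformation that is compatible with the laxity maps,
with the unit isomorphisms `I ≅ F(0)` (so that its component at `0` is the identity of `I` when
these are taken to be identities), and with the weak units. -/
@[ext]
structure Hom (A B : CoSegalPremonoid M) where
  /-- the underlying natural transformation -/
  σ : A.F ⟶ B.F
  isMonoidal : NatTrans.IsMonoidal σ
  e_comp : A.e ≫ σ.app (op PhiEpi.one) = B.e

/-- The category of commutative co-Segal premonoids of `M`. -/
instance : Category (CoSegalPremonoid M) where
  Hom := Hom
  id A := ⟨𝟙 A.F, inferInstance, by simp⟩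
  comp f g := ⟨f.σ ≫ g.σ,
    haveI := f.isMonoidal
    haveI := g.isMonoidal
    inferInstance,
    by rw [NatTrans.comp_app, ← Category.assoc, f.e_comp, g.e_comp]⟩

variable (M) in
/-- The forgetful functor to the category of diagrams indexed by the opposite of the category of
nonempty finite sets and surjections. It restricts the underlying functor. -/
def forget : CoSegalPremonoid M ⥤ (PhiEpi.Posᵒᵖ ⥤ M) where
  obj A := PhiEpi.nonempty.ι.op ⋙ A.F
  map f := Functor.whiskerLeft PhiEpi.nonempty.ι.op (Hom.σ f)

end CoSegalPremonoid

/-! The left adjoint is built by syntax. Formal expressions of arity `X` are generated from nonempty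
sets, the unit, the weak unit, products and the action of surjections. A diagram `D` gives each
expression an object of values, and each premonoid axiom becomes a morphism between the values of
its two sides. The free premonoid at `X` is the colimit of these values over the free category on
the rewriting steps. Since the tensor product is closed, it preserves colimits in each variable, so
products of expressions induce laxity maps, and every axiom holds because it is one of the steps.
Normality holds because an expression of arity zero involves no generator and no weak unit: a
surjection out of the empty set has empty target. Evaluating expressions in a premonoid gives the
universal property (`freeHomEquiv`).

Sifted colimits of premonoids are computed pointwise, since the tensor product of two sifted colimit
cocones is again a colimit cocone (`isColimitTensor`, `isColimitColimitCocone`). The shape of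
reflexive coequalizers is sifted, so `forget` preserves reflexive coequalizers; it is conservative
because normality fixes the value at the empty set. The crude monadicity theorem then applies.

For local presentability, colimits of premonoids come from lifting the left adjoint of the
constant-diagram functor along a monadic functor (`hasColimitsOfShape_of_reflexive`). Filtered
colimits are sifted, so evaluation at a nonempty set is accessible; its left adjoint therefore
preserves presentable objects and carries a strong generator of `M` to a strong generator of
premonoids. -/

/-! ### Jointly epimorphic families -/

section JointlyEpi

variable {M : Type u} [Category.{w} M]

/-- A family of morphisms with a common target is jointly epimorphic when morphisms out of the
target are determined by their composites with the members of the family. -/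
def JointlyEpi {I : Type*} {A : I → M} {B : M} (p : ∀ i, A i ⟶ B) : Prop :=
  ∀ ⦃Z : M⦄ (f g : B ⟶ Z), (∀ i, p i ≫ f = p i ≫ g) → f = g

namespace JointlyEpi

variable [MonoidalCategory M] [MonoidalClosed M] {I J : Type*} {A : I → M} {B : M}
  {p : ∀ i, A i ⟶ B} {A' : J → M} {B' : M} {q : ∀ j, A' j ⟶ B'}

/-- Tensoring with `X` is a left adjoint, so two maps out of `X ⊗ B` can be compared after currying.
-/
theorem whiskerLeft (hp : JointlyEpi p) (X : M) : JointlyEpi fun i => X ◁ p i := by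
  intro Z f g h
  apply MonoidalClosed.curry_injective
  apply hp
  intro i
  rw [← MonoidalClosed.curry_natural_left, ← MonoidalClosed.curry_natural_left, h]

theorem whiskerRight [BraidedCategory M] (hp : JointlyEpi p) (X : M) :
    JointlyEpi fun i => p i ▷ X := by
  intro Z f g h
  rw [← cancel_epi (β_ X B).hom]
  apply hp.whiskerLeft X
  intro i
  rw [BraidedCategory.braiding_naturality_right_assoc,
    BraidedCategory.braiding_naturality_right_assoc, h]

/-- This is what allows identities between maps out of tensor products of colimits, such as the lax
monoidal axioms, to be tested on expressions. -/
theorem tensor [BraidedCategory M] (hp : JointlyEpi p) (hq : JointlyEpi q) :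
    JointlyEpi fun k : I × J => p k.1 ⊗ₘ q k.2 := by
  intro Z f g h
  apply hp.whiskerRight B'
  intro i
  apply hq.whiskerLeft (A i)
  intro j
  simpa [MonoidalCategory.tensorHom_def'] using h (i, j)

end JointlyEpi

end JointlyEpi

section Whisker

variable {M : Type u} [Category.{w} M] [MonoidalCategory M]

namespace CoSegalPremonoid

theorem tensorHom_comp_whiskerRight_assoc {A A' B B' C Z : M} (f : A ⟶ A') (g : B ⟶ B')
    (h : A' ⟶ C) (k : C ⊗ B' ⟶ Z) : (f ⊗ₘ g) ≫ h ▷ B' ≫ k = (f ≫ h ⊗ₘ g) ≫ k := by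
  simp [MonoidalCategory.tensorHom_def']

theorem tensorHom_comp_whiskerLeft_assoc {A A' B B' C Z : M} (f : A ⟶ A') (g : B ⟶ B')
    (h : B' ⟶ C) (k : A' ⊗ C ⟶ Z) : (f ⊗ₘ g) ≫ A' ◁ h ≫ k = (f ⊗ₘ g ≫ h) ≫ k := by
  simp [MonoidalCategory.tensorHom_def]

end CoSegalPremonoid

end Whisker

/-! ### Formal expressions in the operations of a commutative co-Segal premonoid -/

namespace PhiEpi

/-- Formal expressions of a given arity in generators (one for every nonempty set), a unit, a weak
unit, products, and the action of surjections. -/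
inductive Term : PhiEpi → Type
  | gen (X : Pos) : Term X.obj
  | unit : Term (𝟙_ PhiEpi)
  | weak : Term one
  | mul {X Y : PhiEpi} (s : Term X) (t : Term Y) : Term (X ⊗ Y)
  | act {X Y : PhiEpi} (f : X ⟶ Y) (t : Term Y) : Term X

/-- The elementary steps that rewrite an expression into an equivalent one. -/
inductive Step : {X : PhiEpi} → Term X → Term X → Type
  | actId {X : PhiEpi} (t : Term X) : Step (.act (𝟙 X) t) t
  | actComp {X Y Z : PhiEpi} (f : X ⟶ Y) (g : Y ⟶ Z) (t : Term Z) :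
      Step (.act (f ≫ g) t) (.act f (.act g t))
  | actGen {X Y : Pos} (f : X.obj ⟶ Y.obj) : Step (.act f (.gen Y)) (.gen X)
  | actMulLeft {X X' Y : PhiEpi} (f : X ⟶ X') (s : Term X') (t : Term Y) :
      Step (.mul (.act f s) t) (.act (f ▷ Y) (.mul s t))
  | actMulRight {X Y Y' : PhiEpi} (f : Y ⟶ Y') (s : Term X) (t : Term Y') :
      Step (.mul s (.act f t)) (.act (X ◁ f) (.mul s t))
  | assoc {X Y Z : PhiEpi} (r : Term X) (s : Term Y) (t : Term Z) :
      Step (.act (α_ X Y Z).inv (.mul (.mul r s) t)) (.mul r (.mul s t))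
  | comm {X Y : PhiEpi} (s : Term X) (t : Term Y) :
      Step (.act (β_ Y X).hom (.mul s t)) (.mul t s)
  | unitMul {X : PhiEpi} (t : Term X) : Step (.act (λ_ X).inv (.mul .unit t)) t
  | mulUnit {X : PhiEpi} (t : Term X) : Step (.act (ρ_ X).inv (.mul t .unit)) t
  | weakMul (t : Term one) : Step (.mul .weak t) (.act fold t)
  | congrAct {X Y : PhiEpi} (f : X ⟶ Y) {s t : Term Y} (h : Step s t) :
      Step (.act f s) (.act f t)
  | congrMulLeft {X Y : PhiEpi} {s s' : Term X} (h : Step s s') (t : Term Y) :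
      Step (.mul s t) (.mul s' t)
  | congrMulRight {X Y : PhiEpi} (s : Term X) {t t' : Term Y} (h : Step t t') :
      Step (.mul s t) (.mul s t')

instance (X : PhiEpi) : Quiver (Term X) := ⟨Step⟩

variable {M : Type u} [Category.{w} M] [MonoidalCategory M] [SymmetricCategory M]

/-- The object of values of an expression, when the generators take values in `D`. -/
@[reducible] def Term.val (D : Posᵒᵖ ⥤ M) : {X : PhiEpi} → Term X → M
  | _, .gen X => D.obj (op X)
  | _, .unit => 𝟙_ M
  | _, .weak => 𝟙_ M
  | _, .mul s t => s.val D ⊗ t.val D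
  | _, .act _ t => t.val D

/-- The morphism between objects of values that is induced by a rewriting step. -/
def Step.hom (D : Posᵒᵖ ⥤ M) : {X : PhiEpi} → {s t : Term X} → Step s t → (s.val D ⟶ t.val D)
  | _, _, _, .actId t => 𝟙 (t.val D)
  | _, _, _, .actComp _ _ t => 𝟙 (t.val D)
  | _, _, _, .actGen f => D.map (ObjectProperty.homMk f).op
  | _, _, _, .actMulLeft _ s t => 𝟙 (s.val D ⊗ t.val D)
  | _, _, _, .actMulRight _ s t => 𝟙 (s.val D ⊗ t.val D)
  | _, _, _, .assoc r s t => (α_ (r.val D) (s.val D) (t.val D)).hom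
  | _, _, _, .comm s t => (β_ (s.val D) (t.val D)).hom
  | _, _, _, .unitMul t => (λ_ (t.val D)).hom
  | _, _, _, .mulUnit t => (ρ_ (t.val D)).hom
  | _, _, _, .weakMul t => (λ_ (t.val D)).hom
  | _, _, _, .congrAct _ h => h.hom D
  | _, _, _, .congrMulLeft h t => h.hom D ▷ t.val D
  | _, _, _, .congrMulRight s h => s.val D ◁ h.hom D

end PhiEpi

/-! ### The free premonoid as a colimit, and descent out of it in one and two variables -/

namespace CoSegalPremonoid

open PhiEpi Limits

noncomputable section

variable {M : Type u} [Category.{w} M] [MonoidalCategory M] (D : Posᵒᵖ ⥤ M)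

section Obj

variable [SymmetricCategory M]

/-- The diagram of the objects of values of all expressions of a given arity. -/
def freeDiagram (X : PhiEpi) : Paths (Term X) ⥤ M :=
  Paths.lift { obj := fun t => t.val D, map := fun h => Step.hom D h }

variable [HasColimitsOfSize.{0, 0} M]

/-- The value of the free premonoid on `D`. -/
def freeObj (X : PhiEpi) : M := colimit (freeDiagram D X)

/-- The inclusion of the object of values of an expression into the free premonoid. -/
def freeι {X : PhiEpi} (t : Term X) : t.val D ⟶ freeObj D X := colimit.ι (freeDiagram D X) t

theorem freeι_step {X : PhiEpi} {s t : Term X} (h : Step s t) :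
    h.hom D ≫ freeι D t = freeι D s := by
  have := colimit.w (freeDiagram D X) ((Paths.of (Term X)).map h)
  rwa [show (freeDiagram D X).map ((Paths.of (Term X)).map h) = h.hom D from
    Paths.lift_toPath _ _] at this

theorem jointlyEpi_freeι (X : PhiEpi) : JointlyEpi fun t : Term X => freeι D t :=
  fun _ _ _ h => colimit.hom_ext h

/-- A morphism out of the free premonoid is given by a compatible family of morphisms. -/
def freeDesc {X : PhiEpi} {Z : M} (f : ∀ t : Term X, t.val D ⟶ Z)
    (hf : ∀ ⦃s t : Term X⦄ (h : Step s t), h.hom D ≫ f t = f s) : freeObj D X ⟶ Z :=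
  colimit.desc (freeDiagram D X)
    { pt := Z
      ι :=
        { app := f
          naturality := by
            intro s t p
            refine Eq.trans ?_ (Category.comp_id _).symm
            -- The index category is free on the steps, so induction on paths reduces naturality to
            -- single steps.
            refine Quiver.Path.rec (motive := fun t p => (freeDiagram D X).map p ≫ f t = f s)
              (Category.id_comp _) (fun p h ih => ?_) p
            refine (Category.assoc _ _ _).trans (Eq.trans ?_ ih)
            exact congrArg (fun k => (freeDiagram D X).map p ≫ k) (hf h) } }

theorem freeι_desc {X : PhiEpi} {Z : M} (f : ∀ t : Term X, t.val D ⟶ Z)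
    (hf : ∀ ⦃s t : Term X⦄ (h : Step s t), h.hom D ≫ f t = f s) (t : Term X) :
    freeι D t ≫ freeDesc D f hf = f t :=
  colimit.ι_desc _ _

variable [MonoidalClosed M]

section

variable {X Y : PhiEpi} {Z : M} (f : ∀ (s : Term X) (t : Term Y), s.val D ⊗ t.val D ⟶ Z)
  (hl : ∀ ⦃s s' : Term X⦄ (h : Step s s') (t : Term Y), h.hom D ▷ t.val D ≫ f s' t = f s t)
  (hr : ∀ (s : Term X) ⦃t t' : Term Y⦄ (h : Step t t'), s.val D ◁ h.hom D ≫ f s t' = f s t)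

/-- Descent in the second variable. -/
def freeDescRight (s : Term X) : s.val D ⊗ freeObj D Y ⟶ Z :=
  MonoidalClosed.uncurry (freeDesc D (fun t => MonoidalClosed.curry (f s t))
    fun _ _ h => by rw [← MonoidalClosed.curry_natural_left, hr])

theorem freeι_descRight (s : Term X) (t : Term Y) :
    s.val D ◁ freeι D t ≫ freeDescRight D f hr s = f s t := by
  rw [freeDescRight, ← MonoidalClosed.uncurry_natural_left, freeι_desc,
    MonoidalClosed.uncurry_curry]

/-- A morphism out of a tensor product of two values of the free premonoid is given by a family of
morphisms that is compatible in both variables. -/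
def freeDesc₂ : freeObj D X ⊗ freeObj D Y ⟶ Z :=
  -- Currying handles only the right tensor factor; the braiding moves the first variable there once
  -- the second has descended.
  (β_ _ _).hom ≫ MonoidalClosed.uncurry (freeDesc D
    (fun s => MonoidalClosed.curry ((β_ _ _).hom ≫ freeDescRight D f hr s)) fun s s' h => by
      rw [← MonoidalClosed.curry_natural_left]
      congr 1
      rw [BraidedCategory.braiding_naturality_right_assoc]
      congr 1
      apply (jointlyEpi_freeι D Y).whiskerLeft
      intro t
      rw [whisker_exchange_assoc, freeι_descRight, freeι_descRight, hl])

theorem freeι_desc₂ (s : Term X) (t : Term Y) :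
    (freeι D s ⊗ₘ freeι D t) ≫ freeDesc₂ D f hl hr = f s t := by
  rw [freeDesc₂, BraidedCategory.braiding_naturality_assoc, MonoidalCategory.tensorHom_def, Category.assoc,
    ← MonoidalClosed.uncurry_natural_left, freeι_desc, MonoidalClosed.uncurry_curry,
    BraidedCategory.braiding_naturality_left_assoc, SymmetricCategory.symmetry_assoc,
    freeι_descRight]

end

end Obj

end

end CoSegalPremonoid

/-! ### The premonoid structure on the free object, and its normality -/

namespace CoSegalPremonoid

open PhiEpi Limits

noncomputable section

variable {M : Type u} [Category.{w} M] [MonoidalCategory M] [SymmetricCategory M]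
  (D : Posᵒᵖ ⥤ M)

/-- Expressions of arity zero have the unit object as their object of values. -/
def freeAug : {X : PhiEpi} → (t : Term X) → X.n = 0 → (t.val D ⟶ 𝟙_ M)
  | _, .gen X, h => (X.property h).elim
  | _, .unit, _ => 𝟙 _
  | _, .weak, h => (Nat.one_ne_zero h).elim
  | _, .mul s t, h => (freeAug s (Nat.eq_zero_of_add_eq_zero_right h) ⊗ₘ
      freeAug t (Nat.eq_zero_of_add_eq_zero_left h)) ≫ (λ_ (𝟙_ M)).hom
  -- A surjection from the empty set has empty target, so arity zero passes to the subexpression.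
  -- With arbitrary functions in place of surjections this would fail.
  | _, .act f t, h => freeAug t (by
      by_contra h'
      exact Fin.elim0 (h ▸ (f.surj ⟨0, Nat.pos_of_ne_zero h'⟩).choose))

/-- Makes the augmentations a cocone on the diagram at the empty set, which yields the inverse of
the unit map. The cases `assoc`, `comm` and `mulUnit` rest on the equality of the two unitors at the
unit object; steps that involve a generator or the weak unit at top level have nonzero arity. -/
theorem freeAug_step {X : PhiEpi} {s t : Term X} (h : Step s t) (hX : X.n = 0) :
    h.hom D ≫ freeAug D t hX = freeAug D s hX := by
  induction h with
  | actId t => exact Category.id_comp _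
  | actComp f g t => exact Category.id_comp _
  | @actGen X Y f => exact (X.property hX).elim
  | actMulLeft f s t => exact Category.id_comp _
  | actMulRight f s t => exact Category.id_comp _
  | assoc r s t =>
    dsimp only [freeAug, Step.hom]
    have hl : ∀ {A B C : M} (a : A ⟶ 𝟙_ M) (b : B ⟶ 𝟙_ M) (c : C ⟶ 𝟙_ M),
        (α_ A B C).hom ≫ (a ⊗ₘ ((b ⊗ₘ c) ≫ (λ_ (𝟙_ M)).hom)) ≫ (λ_ (𝟙_ M)).hom =
          (((a ⊗ₘ b) ≫ (λ_ (𝟙_ M)).hom) ⊗ₘ c) ≫ (λ_ (𝟙_ M)).hom := fun a b c => by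
      rw [← Category.comp_id a, ← MonoidalCategory.tensorHom_comp_tensorHom, Category.comp_id,
        Category.assoc, ← MonoidalCategory.associator_naturality_assoc, ← Category.comp_id c,
        ← MonoidalCategory.tensorHom_comp_tensorHom, Category.comp_id, Category.assoc,
        id_tensorHom, tensorHom_id]
      simp [unitors_equal]
    exact hl _ _ _
  | comm s t =>
    dsimp only [freeAug, Step.hom]
    rw [← BraidedCategory.braiding_naturality_assoc, braiding_leftUnitor, unitors_equal]
  | unitMul t =>
    dsimp only [freeAug, Step.hom]
    rw [id_tensorHom, leftUnitor_naturality]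
  | mulUnit t =>
    dsimp only [freeAug, Step.hom]
    rw [tensorHom_id, unitors_equal, rightUnitor_naturality]
  | weakMul t => exact (Nat.succ_ne_zero _ hX).elim
  | congrAct f h ih => exact ih _
  | congrMulLeft h t ih =>
    dsimp only [freeAug, Step.hom]
    rw [← tensorHom_id, MonoidalCategory.tensorHom_comp_tensorHom_assoc, ih, Category.id_comp]
  | congrMulRight s h ih =>
    dsimp only [freeAug, Step.hom]
    rw [← id_tensorHom, MonoidalCategory.tensorHom_comp_tensorHom_assoc, ih, Category.id_comp]

variable [HasColimitsOfSize.{0, 0} M]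

/-- The action of a surjection on the free premonoid. -/
def freeMap {X Y : PhiEpi} (f : X ⟶ Y) : freeObj D Y ⟶ freeObj D X :=
  freeDesc D (fun t => freeι D (.act f t)) fun _ _ h => freeι_step D (.congrAct f h)

theorem freeι_map {X Y : PhiEpi} (f : X ⟶ Y) (t : Term Y) :
    freeι D t ≫ freeMap D f = freeι D (.act f t) :=
  freeι_desc _ _ _ _

theorem freeι_map_assoc {X Y : PhiEpi} (f : X ⟶ Y) (t : Term Y) {Z : M} (k : freeObj D X ⟶ Z) :
    freeι D t ≫ freeMap D f ≫ k = (freeι D (.act f t) : t.val D ⟶ _) ≫ k := by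
  rw [← Category.assoc, freeι_map]

theorem freeMap_id (X : PhiEpi) : freeMap D (𝟙 X) = 𝟙 (freeObj D X) :=
  jointlyEpi_freeι D _ _ _ fun t => by
    beta_reduce
    rw [freeι_map, Category.comp_id]
    exact (freeι_step D (.actId t)).symm.trans (Category.id_comp _)

theorem freeMap_comp {X Y Z : PhiEpi} (f : X ⟶ Y) (g : Y ⟶ Z) :
    freeMap D (f ≫ g) = freeMap D g ≫ freeMap D f :=
  jointlyEpi_freeι D _ _ _ fun t => by
    beta_reduce
    rw [freeι_map, freeι_map_assoc, freeι_map]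
    exact (freeι_step D (.actComp f g t)).symm.trans (Category.id_comp _)

variable [MonoidalClosed M]

/-- The multiplication of the free premonoid. -/
def freeμ (X Y : PhiEpi) : freeObj D X ⊗ freeObj D Y ⟶ freeObj D (X ⊗ Y) :=
  freeDesc₂ D (fun s t => freeι D (.mul s t)) (fun _ _ h t => freeι_step D (.congrMulLeft h t))
    fun s _ _ h => freeι_step D (.congrMulRight s h)

theorem freeι_μ {X Y : PhiEpi} (s : Term X) (t : Term Y) :
    (freeι D s ⊗ₘ freeι D t) ≫ freeμ D X Y = freeι D (.mul s t) :=
  freeι_desc₂ _ _ _ _ _ _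

theorem freeι_μ_assoc {X Y : PhiEpi} (s : Term X) (t : Term Y) {Z : M}
    (k : freeObj D (X ⊗ Y) ⟶ Z) : (freeι D s ⊗ₘ freeι D t) ≫ freeμ D X Y ≫ k =
      (freeι D (.mul s t) : s.val D ⊗ t.val D ⟶ _) ≫ k := by
  rw [← Category.assoc, freeι_μ]

theorem jointlyEpi_freeι_tensor (X Y : PhiEpi) :
    JointlyEpi fun k : Term X × Term Y => freeι D k.1 ⊗ₘ freeι D k.2 :=
  (jointlyEpi_freeι D X).tensor (jointlyEpi_freeι D Y)

theorem freeMap_whiskerRight_μ {X Y : PhiEpi} (f : X ⟶ Y) (Z : PhiEpi) :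
    freeMap D f ▷ freeObj D Z ≫ freeμ D X Z = freeμ D Y Z ≫ freeMap D (f ▷ Z) :=
  jointlyEpi_freeι_tensor D _ _ _ _ fun ⟨s, t⟩ => by
    beta_reduce
    rw [← tensorHom_id, MonoidalCategory.tensorHom_comp_tensorHom_assoc, Category.comp_id,
      freeι_map, freeι_μ, freeι_μ_assoc, freeι_map]
    exact (freeι_step D (.actMulLeft f s t)).symm.trans (Category.id_comp _)

theorem freeMap_whiskerLeft_μ {X Y : PhiEpi} (Z : PhiEpi) (f : X ⟶ Y) :
    freeObj D Z ◁ freeMap D f ≫ freeμ D Z X = freeμ D Z Y ≫ freeMap D (Z ◁ f) :=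
  jointlyEpi_freeι_tensor D _ _ _ _ fun ⟨s, t⟩ => by
    beta_reduce
    rw [← id_tensorHom, MonoidalCategory.tensorHom_comp_tensorHom_assoc, Category.comp_id,
      freeι_map, freeι_μ, freeι_μ_assoc, freeι_map]
    exact (freeι_step D (.actMulRight f s t)).symm.trans (Category.id_comp _)

/-- As with the other axioms below, restricting to expressions turns both sides into inclusions of
two expressions related by a single step, here `Step.assoc`. -/
theorem freeμ_assoc (X Y Z : PhiEpi) :
    freeμ D X Y ▷ freeObj D Z ≫ freeμ D (X ⊗ Y) Z ≫ freeMap D (α_ X Y Z).inv =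
      (α_ (freeObj D X) (freeObj D Y) (freeObj D Z)).hom ≫
        freeObj D X ◁ freeμ D Y Z ≫ freeμ D X (Y ⊗ Z) :=
  (jointlyEpi_freeι_tensor D X Y).tensor (jointlyEpi_freeι D Z) _ _ fun ⟨⟨r, s⟩, t⟩ => by
    beta_reduce
    dsimp only
    rw [← tensorHom_id, ← id_tensorHom, MonoidalCategory.tensorHom_comp_tensorHom_assoc,
      Category.comp_id, freeι_μ, freeι_μ_assoc, freeι_map,
      MonoidalCategory.associator_naturality_assoc,
      MonoidalCategory.tensorHom_comp_tensorHom_assoc, Category.comp_id, freeι_μ, freeι_μ]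
    exact (freeι_step D (.assoc r s t)).symm

theorem freeμ_comm (X Y : PhiEpi) :
    freeμ D X Y ≫ freeMap D (β_ Y X).hom =
      (β_ (freeObj D X) (freeObj D Y)).hom ≫ freeμ D Y X :=
  jointlyEpi_freeι_tensor D _ _ _ _ fun ⟨s, t⟩ => by
    beta_reduce
    rw [freeι_μ_assoc, freeι_map, BraidedCategory.braiding_naturality_assoc, freeι_μ]
    exact (freeι_step D (.comm s t)).symm

theorem freeμ_unit_left (X : PhiEpi) : (λ_ (freeObj D X)).hom =
    (freeι D .unit : 𝟙_ M ⟶ _) ▷ freeObj D X ≫ freeμ D (𝟙_ PhiEpi) X ≫ freeMap D (λ_ X).inv :=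
  (jointlyEpi_freeι D X).whiskerLeft (𝟙_ M) _ _ fun t => by
    beta_reduce
    rw [leftUnitor_naturality, ← tensorHom_def'_assoc, freeι_μ_assoc,
      freeι_map]
    exact freeι_step D (.unitMul t)

theorem freeμ_unit_right (X : PhiEpi) : (ρ_ (freeObj D X)).hom =
    freeObj D X ◁ (freeι D .unit : 𝟙_ M ⟶ _) ≫ freeμ D X (𝟙_ PhiEpi) ≫ freeMap D (ρ_ X).inv :=
  (jointlyEpi_freeι D X).whiskerRight (𝟙_ M) _ _ fun t => by
    beta_reduce
    rw [rightUnitor_naturality, ← MonoidalCategory.tensorHom_def_assoc, freeι_μ_assoc,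
      freeι_map]
    exact freeι_step D (.mulUnit t)

theorem freeμ_weak : (freeι D .weak : 𝟙_ M ⟶ _) ▷ freeObj D one ≫ freeμ D one one =
    (λ_ (freeObj D one)).hom ≫ freeMap D fold :=
  (jointlyEpi_freeι D one).whiskerLeft (𝟙_ M) _ _ fun t => by
    beta_reduce
    rw [leftUnitor_naturality_assoc, ← tensorHom_def'_assoc, freeι_μ, freeι_map]
    exact (freeι_step D (.weakMul t)).symm

/-- The underlying functor of the free premonoid. -/
@[reducible] def freeFunctor : PhiEpiᵒᵖ ⥤ M where
  obj X := freeObj D X.unop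
  map f := freeMap D f.unop
  map_id X := freeMap_id D X.unop
  map_comp f g := freeMap_comp D g.unop f.unop

/-- The symmetric lax structure of the free premonoid. -/
instance freeLaxBraided : (freeFunctor D).LaxBraided where
  ε := freeι D .unit
  μ X Y := freeμ D X.unop Y.unop
  μ_natural_left f X := freeMap_whiskerRight_μ D f.unop X.unop
  μ_natural_right X f := freeMap_whiskerLeft_μ D X.unop f.unop
  associativity X Y Z := freeμ_assoc D X.unop Y.unop Z.unop
  left_unitality X := freeμ_unit_left D X.unop
  right_unitality X := freeμ_unit_right D X.unop
  braided X Y := freeμ_comm D X.unop Y.unop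

/-- Morphisms to the empty set are unique. -/
theorem hom_unit_ext {X : PhiEpi} (f g : X ⟶ 𝟙_ PhiEpi) : f = g :=
  PhiEpi.hom_ext fun i => (f.toFun i).elim0

/-- The product case of `freeAug_freeι`. It is the left unit law of the free object, combined with
the fact that the empty set has only one endomorphism. -/
theorem tensor_unit_freeμ {A B : M} (a : A ⟶ 𝟙_ M) (b : B ⟶ 𝟙_ M)
    (f : 𝟙_ PhiEpi ⊗ 𝟙_ PhiEpi ⟶ 𝟙_ PhiEpi) :
    ((a ⊗ₘ b) ≫ (λ_ (𝟙_ M)).hom) ≫ (freeι D .unit : 𝟙_ M ⟶ _) ≫ freeMap D f =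
      (a ≫ (freeι D .unit : 𝟙_ M ⟶ _) ⊗ₘ b ≫ (freeι D .unit : 𝟙_ M ⟶ _)) ≫
        freeμ D (𝟙_ PhiEpi) (𝟙_ PhiEpi) := by
  have h : f ≫ (λ_ (𝟙_ PhiEpi)).inv = 𝟙 _ := PhiEpi.hom_ext fun i => i.elim0
  rw [← MonoidalCategory.tensorHom_comp_tensorHom, Category.assoc, Category.assoc,
    ← leftUnitor_naturality_assoc, freeμ_unit_left, Category.assoc, Category.assoc,
    ← freeMap_comp, h, freeMap_id, MonoidalCategory.tensorHom_def' (freeι D .unit : 𝟙_ M ⟶ _),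
    Category.comp_id, Category.assoc]

/-- Each inclusion at arity zero factors through the formal unit, which is the nontrivial half of
normality. The map `f` is carried along because `X` is the empty set only up to a propositional
equality during the induction. -/
theorem freeAug_freeι {X : PhiEpi} (t : Term X) (h : X.n = 0) (f : X ⟶ 𝟙_ PhiEpi) :
    freeAug D t h ≫ (freeι D .unit : 𝟙_ M ⟶ _) ≫ freeMap D f = freeι D t := by
  induction t with
  | gen X => exact (X.property h).elim
  | weak => exact (Nat.one_ne_zero h).elim
  | unit =>
    rw [hom_unit_ext f (𝟙 _), freeMap_id]
    exact (Category.id_comp _).trans (Category.comp_id _)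
  | @mul X Y s t hs ht =>
    obtain ⟨X⟩ := X
    obtain ⟨Y⟩ := Y
    obtain rfl : X = 0 := Nat.eq_zero_of_add_eq_zero_right h
    obtain rfl : Y = 0 := Nat.eq_zero_of_add_eq_zero_left h
    have h₁ : freeAug D s rfl ≫ (freeι D .unit : 𝟙_ M ⟶ freeObj D (𝟙_ PhiEpi)) = freeι D s := by
      rw [← hs rfl (𝟙 _), freeMap_id]
      exact congrArg _ (Category.comp_id _).symm
    have h₂ : freeAug D t rfl ≫ (freeι D .unit : 𝟙_ M ⟶ freeObj D (𝟙_ PhiEpi)) = freeι D t := by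
      rw [← ht rfl (𝟙 _), freeMap_id]
      exact congrArg _ (Category.comp_id _).symm
    rw [← freeι_μ D s t, ← h₁, ← h₂]
    exact tensor_unit_freeμ D (freeAug D s rfl) (freeAug D t rfl) f
  | @act X Y g t ih =>
    have hY : Y.n = 0 := by
      by_contra h'
      exact Fin.elim0 (h ▸ (g.surj ⟨0, Nat.pos_of_ne_zero h'⟩).choose)
    obtain ⟨Y⟩ := Y
    obtain rfl : Y = 0 := hY
    rw [← freeι_map, ← ih rfl (𝟙 _), Category.assoc, Category.assoc, ← freeMap_comp,
      hom_unit_ext f (g ≫ 𝟙 _)]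
    rfl

/-- The free premonoid on a diagram indexed by the nonempty finite sets. -/
@[reducible] def free : CoSegalPremonoid M where
  F := freeFunctor D
  lax := freeLaxBraided D
  normal := by
    have h : ∀ t : Term (𝟙_ PhiEpi), freeAug D t rfl ≫ freeι D .unit = freeι D t := fun t => by
      rw [← freeAug_freeι D t rfl (𝟙 _), freeMap_id]
      exact congrArg _ (Category.comp_id _).symm
    refine ⟨freeDesc D (fun t => freeAug D t rfl) fun _ _ h => freeAug_step D h rfl,
      freeι_desc _ _ _ _, jointlyEpi_freeι D _ _ _ fun t => ?_⟩
    refine (Category.assoc _ _ _).symm.trans (Eq.trans ?_ (Category.comp_id _).symm)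
    exact (congrArg (· ≫ freeι D .unit) (freeι_desc _ _ _ _)).trans (h t)
  e := freeι D .weak
  weak_unit := freeμ_weak D

end

end CoSegalPremonoid

/-! ### Evaluation of expressions and the universal property of the free premonoid -/

namespace CoSegalPremonoid

open PhiEpi Limits Functor.LaxMonoidal

noncomputable section

variable {M : Type u} [Category.{w} M] [MonoidalCategory M] [SymmetricCategory M]

@[ext]
theorem hom_ext {A B : CoSegalPremonoid M} {f g : A ⟶ B} (h : Hom.σ f = Hom.σ g) : f = g :=
  Hom.ext h

section Eval

variable {D : Posᵒᵖ ⥤ M} {A : CoSegalPremonoid M} (f : D ⟶ (forget M).obj A)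

/-- Evaluation of expressions in a premonoid. -/
def eval : {X : PhiEpi} → (t : Term X) → (t.val D ⟶ A.F.obj (op X))
  | _, .gen X => f.app (op X)
  | _, .unit => ε A.F
  | _, .weak => A.e
  | _, .mul (X := X) (Y := Y) s t => (eval s ⊗ₘ eval t) ≫ μ A.F (op X) (op Y)
  | _, .act g t => eval t ≫ A.F.map g.op

/-- Each non-congruence step matches one law valid in `A`: functoriality, naturality of `f`,
naturality of the laxity maps, associativity, symmetry, the unit laws or the weak unit law. -/
theorem eval_step {X : PhiEpi} {s t : Term X} (h : Step s t) :
    h.hom D ≫ eval f t = eval f s := by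
  induction h with
  | actId t =>
    dsimp only [eval, Step.hom]
    rw [op_id, A.F.map_id, Category.comp_id, Category.id_comp]
  | actComp g g' t =>
    dsimp only [eval, Step.hom]
    rw [op_comp, A.F.map_comp, Category.assoc, Category.id_comp]
  | @actGen X Y g => exact f.naturality (ObjectProperty.homMk g).op
  | @actMulLeft X X' Y g s t =>
    dsimp only [eval, Step.hom]
    rw [Category.id_comp, Category.assoc, op_whiskerRight, ← μ_natural_left,
      tensorHom_comp_whiskerRight_assoc]
  | actMulRight g s t =>
    dsimp only [eval, Step.hom]
    rw [Category.id_comp, Category.assoc, op_whiskerLeft, ← μ_natural_right,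
      tensorHom_comp_whiskerLeft_assoc]
  | @assoc X Y Z r s t =>
    dsimp only [eval, Step.hom]
    have h := associativity A.F (op X) (op Y) (op Z)
    rw [Category.assoc, ← tensorHom_comp_whiskerRight_assoc, ← tensorHom_comp_whiskerLeft_assoc,
      ← MonoidalCategory.associator_naturality_assoc]
    exact congrArg _ h.symm
  | @comm X Y s t =>
    dsimp only [eval, Step.hom]
    rw [← BraidedCategory.braiding_naturality_assoc, Category.assoc]
    exact congrArg _ (Functor.LaxBraided.braided (F := A.F) (op X) (op Y)).symm
  | @unitMul X t =>
    dsimp only [eval, Step.hom]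
    rw [← leftUnitor_naturality, left_unitality, MonoidalCategory.tensorHom_def',
      Category.assoc, Category.assoc]
    rfl
  | mulUnit t =>
    dsimp only [eval, Step.hom]
    rw [← rightUnitor_naturality, right_unitality, MonoidalCategory.tensorHom_def,
      Category.assoc, Category.assoc]
    rfl
  | weakMul t =>
    dsimp only [eval, Step.hom]
    rw [← leftUnitor_naturality_assoc, ← A.weak_unit, MonoidalCategory.tensorHom_def',
      Category.assoc]
  | congrAct g h ih =>
    dsimp only [eval, Step.hom]
    rw [← Category.assoc, ih]
  | congrMulLeft h t ih =>
    dsimp only [eval, Step.hom]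
    rw [← tensorHom_id, MonoidalCategory.tensorHom_comp_tensorHom_assoc, ih, Category.id_comp]
  | congrMulRight s h ih =>
    dsimp only [eval, Step.hom]
    rw [← id_tensorHom, MonoidalCategory.tensorHom_comp_tensorHom_assoc, ih, Category.id_comp]

variable [HasColimitsOfSize.{0, 0} M]

/-- The components of the morphism out of the free premonoid that extends a given morphism. -/
def freeLiftApp (X : PhiEpi) : freeObj D X ⟶ A.F.obj (op X) :=
  freeDesc D (fun t => eval f t) fun _ _ h => eval_step f h

theorem freeι_liftApp {X : PhiEpi} (t : Term X) : freeι D t ≫ freeLiftApp f X = eval f t :=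
  freeι_desc _ _ _ _

variable [MonoidalClosed M]

/-- The morphism out of the free premonoid that extends a given morphism. -/
def freeLift : free D ⟶ A where
  σ :=
    { app := fun X => freeLiftApp f X.unop
      naturality := fun X Y g => jointlyEpi_freeι D _ _ _ fun t => by
        refine (freeι_map_assoc D g.unop t _).trans ?_
        refine (freeι_liftApp f (.act g.unop t)).trans ?_
        exact (congrArg (· ≫ A.F.map g) (freeι_liftApp f t)).symm.trans (Category.assoc _ _ _) }
  isMonoidal :=
    { unit := freeι_liftApp f .unit
      tensor := fun X Y => jointlyEpi_freeι_tensor D _ _ _ _ fun ⟨s, t⟩ => by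
        refine (freeι_μ_assoc D s t _).trans ?_
        refine (freeι_liftApp f (.mul s t)).trans ?_
        refine Eq.trans ?_ (Category.assoc _ _ _)
        beta_reduce
        rw [MonoidalCategory.tensorHom_comp_tensorHom]
        exact congrArg (· ≫ μ A.F X Y)
          (congrArg₂ (· ⊗ₘ ·) (freeι_liftApp f s).symm (freeι_liftApp f t).symm) }
  e_comp := freeι_liftApp f .weak

theorem freeι_lift {X : PhiEpi} (t : Term X) :
    freeι D t ≫ (Hom.σ (freeLift f)).app (op X) = eval f t :=
  freeι_liftApp f t

end Eval

variable [HasColimitsOfSize.{0, 0} M] [MonoidalClosed M]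

/-- The inclusion of the generators. -/
def freeUnit (D : Posᵒᵖ ⥤ M) : D ⟶ (forget M).obj (free D) where
  app X := freeι D (.gen X.unop)
  naturality X Y f := by
    refine Eq.trans ?_ (freeι_map D f.unop.hom (.gen X.unop)).symm
    exact freeι_step D (.actGen f.unop.hom)

/-- The uniqueness half of the universal property: a morphism out of the free premonoid respects
every operation, so its values on generators determine it on all expressions. -/
theorem eval_freeUnit {D : Posᵒᵖ ⥤ M} {A : CoSegalPremonoid M} (g : free D ⟶ A) {X : PhiEpi}
    (t : Term X) : eval (freeUnit D ≫ (forget M).map g) t =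
      freeι D t ≫ (Hom.σ g).app (op X) := by
  induction t with
  | gen X => rfl
  | unit => exact (g.isMonoidal.unit).symm
  | weak => exact g.e_comp.symm
  | @mul X Y s t hs ht =>
    dsimp only [eval]
    rw [hs, ht, ← freeι_μ, Category.assoc, ← MonoidalCategory.tensorHom_comp_tensorHom,
      Category.assoc]
    exact congrArg _ (g.isMonoidal.tensor (op X) (op Y)).symm
  | @act X Y f t ih =>
    dsimp only [eval]
    rw [ih, ← freeι_map, Category.assoc, Category.assoc]
    exact congrArg _ ((Hom.σ g).naturality f.op).symm

/-- The universal property of the free premonoid. -/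
def freeHomEquiv (D : Posᵒᵖ ⥤ M) (A : CoSegalPremonoid M) :
    (free D ⟶ A) ≃ (D ⟶ (forget M).obj A) where
  toFun g := freeUnit D ≫ (forget M).map g
  invFun f := freeLift f
  left_inv g := by
    ext X
    refine jointlyEpi_freeι D _ _ _ fun t => ?_
    exact (freeι_lift _ t).trans (eval_freeUnit g t)
  right_inv f := by
    ext X
    exact freeι_lift f (.gen X.unop)

theorem freeHomEquiv_comp (D : Posᵒᵖ ⥤ M) (A B : CoSegalPremonoid M) (g : A ⟶ B)
    (f : free D ⟶ A) : freeHomEquiv D B (f ≫ g) = freeHomEquiv D A f ≫ (forget M).map g :=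
  (congrArg (freeUnit D ≫ ·) ((forget M).map_comp f g)).trans (Category.assoc _ _ _).symm

variable (M) in
/-- The free premonoid functor. -/
def freePremonoid : (Posᵒᵖ ⥤ M) ⥤ CoSegalPremonoid M :=
  Adjunction.leftAdjointOfEquiv freeHomEquiv freeHomEquiv_comp

variable (M) in
/-- The free premonoid functor is left adjoint to the forgetful functor. -/
def freeAdjunction : freePremonoid M ⊣ forget M :=
  Adjunction.adjunctionOfEquivLeft freeHomEquiv freeHomEquiv_comp

end

end CoSegalPremonoid

/-! ### Sifted colimits of premonoids and conservativity of the forgetful functor -/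

namespace CoSegalPremonoid

open PhiEpi Limits Functor.LaxMonoidal

noncomputable section

variable {M : Type u} [Category.{w} M] [MonoidalCategory M]

section Tensor

variable [BraidedCategory M] [MonoidalClosed M] {J : Type*} [Category J] [IsSifted J]
  {F₁ F₂ : J ⥤ M} {c₁ : Cocone F₁} {c₂ : Cocone F₂} (h₁ : IsColimit c₁) (h₂ : IsColimit c₂)

/-- Over a sifted category, the tensor product of two colimit cocones is a colimit cocone. -/
def isColimitTensor : IsColimit (c₁.tensor c₂) :=
  -- Closedness and the braiding give preservation in each variable separately; siftedness then
  -- permits restriction to the diagonal.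
  haveI (X : M) : PreservesColimit F₂ ((curriedTensor M).obj X) :=
    inferInstanceAs (PreservesColimit F₂ (tensorLeft X))
  haveI (X : M) : PreservesColimit F₁ ((curriedTensor M).flip.obj X) :=
    inferInstanceAs (PreservesColimit F₁ (tensorRight X))
  h₁.tensor h₂

include h₁ h₂ in
theorem jointlyEpi_tensor : JointlyEpi fun j => c₁.ι.app j ⊗ₘ c₂.ι.app j :=
  fun _ _ _ h => (isColimitTensor h₁ h₂).hom_ext h

/-- A morphism out of the tensor product of two sifted colimits. -/
def tensorDesc {Z : M} (f : ∀ j, F₁.obj j ⊗ F₂.obj j ⟶ Z)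
    (hf : ∀ ⦃i j⦄ (g : i ⟶ j), (F₁.map g ⊗ₘ F₂.map g) ≫ f j = f i) : c₁.pt ⊗ c₂.pt ⟶ Z :=
  (isColimitTensor h₁ h₂).desc
    { pt := Z
      ι :=
        { app := f
          naturality := fun _ _ g => (hf g).trans (Category.comp_id _).symm } }

theorem ι_tensorDesc {Z : M} (f : ∀ j, F₁.obj j ⊗ F₂.obj j ⟶ Z)
    (hf : ∀ ⦃i j⦄ (g : i ⟶ j), (F₁.map g ⊗ₘ F₂.map g) ≫ f j = f i) (j : J) :
    (c₁.ι.app j ⊗ₘ c₂.ι.app j) ≫ tensorDesc h₁ h₂ f hf = f j :=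
  (isColimitTensor h₁ h₂).fac _ j

end Tensor

variable [SymmetricCategory M]

variable (M) in
/-- The functor that remembers the underlying diagram on all finite sets. -/
def underlying : CoSegalPremonoid M ⥤ (PhiEpiᵒᵖ ⥤ M) where
  obj A := A.F
  map f := Hom.σ f

instance (A : CoSegalPremonoid M) : IsIso (ε A.F) := A.normal

/-- The inverse of the unit isomorphism of a premonoid. -/
def unitInv (A : CoSegalPremonoid M) : A.F.obj (𝟙_ _) ⟶ 𝟙_ M := inv (ε A.F)

theorem ε_unitInv (A : CoSegalPremonoid M) : ε A.F ≫ unitInv A = 𝟙 _ := IsIso.hom_inv_id _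

theorem unitInv_ε (A : CoSegalPremonoid M) : unitInv A ≫ ε A.F = 𝟙 _ := IsIso.inv_hom_id _

theorem σ_unitInv {A B : CoSegalPremonoid M} (f : A ⟶ B) :
    (Hom.σ f).app (𝟙_ _) ≫ unitInv B = unitInv A := by
  have h : ε A.F ≫ (Hom.σ f).app (𝟙_ _) = ε B.F := f.isMonoidal.unit
  rw [← cancel_epi (ε A.F), ← Category.assoc, h, ε_unitInv, ε_unitInv]

variable [MonoidalClosed M] {J : Type*} [Category J] [IsSifted J]
  {K : J ⥤ CoSegalPremonoid M} {c : Cocone (K ⋙ underlying M)}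

section

variable (hc : ∀ X, IsColimit (((evaluation PhiEpiᵒᵖ M).obj X).mapCocone c))

/-- The cocone inclusions of the underlying diagram. -/
abbrev inc (c : Cocone (K ⋙ underlying M)) (j : J) (X : PhiEpiᵒᵖ) :
    (K.obj j).F.obj X ⟶ c.pt.obj X := (c.ι.app j).app X

omit [MonoidalClosed M] [IsSifted J] in
theorem inc_w (c : Cocone (K ⋙ underlying M)) {i j : J} (g : i ⟶ j) (X : PhiEpiᵒᵖ) :
    (Hom.σ (K.map g)).app X ≫ inc c j X = inc c i X :=
  congrArg (fun k => k.app X) (c.w g)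

omit [MonoidalClosed M] [IsSifted J] in
theorem inc_naturality (j : J) {X Y : PhiEpiᵒᵖ} (f : X ⟶ Y) :
    (K.obj j).F.map f ≫ inc c j Y = inc c j X ≫ c.pt.map f :=
  (c.ι.app j).naturality f

omit [MonoidalClosed M] [IsSifted J] in
include hc in
theorem jointlyEpi_inc (X : PhiEpiᵒᵖ) : JointlyEpi fun j => inc c j X :=
  fun _ _ _ h => (hc X).hom_ext h

include hc in
theorem jointlyEpi_inc_tensor (X Y : PhiEpiᵒᵖ) : JointlyEpi fun j => inc c j X ⊗ₘ inc c j Y :=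
  jointlyEpi_tensor (hc X) (hc Y)

include hc in
-- Allows associativity to be tested with the same index `j` in all three factors, where it is the
-- associativity of `K.obj j`.
theorem jointlyEpi_inc_tensor_tensor (X Y Z : PhiEpiᵒᵖ) :
    JointlyEpi fun j => (inc c j X ⊗ₘ inc c j Y) ⊗ₘ inc c j Z :=
  jointlyEpi_tensor (isColimitTensor (hc X) (hc Y)) (hc Z)

/-- The multiplication of a sifted colimit. -/
def colimitμ (X Y : PhiEpiᵒᵖ) : c.pt.obj X ⊗ c.pt.obj Y ⟶ c.pt.obj (X ⊗ Y) :=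
  tensorDesc (hc X) (hc Y) (fun j => μ (K.obj j).F X Y ≫ inc c j (X ⊗ Y)) fun i j g => by
    have h := (K.map g).isMonoidal.tensor X Y
    rw [← inc_w c g]
    exact (Category.assoc _ _ _).symm.trans
      ((congrArg (· ≫ inc c j (X ⊗ Y)) h.symm).trans (Category.assoc _ _ _))

theorem inc_μ (j : J) (X Y : PhiEpiᵒᵖ) :
    (inc c j X ⊗ₘ inc c j Y) ≫ colimitμ hc X Y = μ (K.obj j).F X Y ≫ inc c j (X ⊗ Y) :=
  ι_tensorDesc (hc X) (hc Y) _ _ j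

theorem inc_μ_assoc (j : J) (X Y : PhiEpiᵒᵖ) {Z : M} (k : c.pt.obj (X ⊗ Y) ⟶ Z) :
    (inc c j X ⊗ₘ inc c j Y) ≫ colimitμ hc X Y ≫ k =
      μ (K.obj j).F X Y ≫ inc c j (X ⊗ Y) ≫ k := by
  rw [← Category.assoc, inc_μ, Category.assoc]

omit [MonoidalClosed M] [IsSifted J] in
/-- A family of global elements that is compatible with the transition maps becomes constant in
the colimit. -/
theorem elements_const [IsConnected J] {X : PhiEpiᵒᵖ} (x : ∀ j, 𝟙_ M ⟶ (K.obj j).F.obj X)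
    (hx : ∀ ⦃i j⦄ (g : i ⟶ j), x i ≫ (Hom.σ (K.map g)).app X = x j) (i j : J) :
    x i ≫ inc c i X = x j ≫ inc c j X :=
  constant_of_preserves_morphisms (fun j => x j ≫ inc c j X)
    (fun i j g => by rw [← hx g, Category.assoc, inc_w]) i j

variable (K c) in
/-- The unit of a sifted colimit. -/
def colimitε : 𝟙_ M ⟶ c.pt.obj (𝟙_ _) :=
  ε (K.obj (Classical.arbitrary J)).F ≫ inc c _ _

omit [MonoidalClosed M] in
theorem colimitε_eq (j : J) : colimitε K c = ε (K.obj j).F ≫ inc c j _ :=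
  elements_const (fun j => ε (K.obj j).F) (fun _ _ g => (K.map g).isMonoidal.unit) _ _

variable (K c) in
/-- The weak unit of a sifted colimit. -/
def colimitE : 𝟙_ M ⟶ c.pt.obj (op one) :=
  (K.obj (Classical.arbitrary J)).e ≫ inc c _ _

omit [MonoidalClosed M] in
theorem colimitE_eq (j : J) : colimitE K c = (K.obj j).e ≫ inc c j _ :=
  elements_const (fun j => (K.obj j).e) (fun _ _ g => (K.map g).e_comp) _ _

/-- The symmetric lax structure of a sifted colimit. -/
abbrev colimitLaxBraided : c.pt.LaxBraided where
  ε := colimitε K c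
  μ := colimitμ hc
  μ_natural_left {X Y} f X' := jointlyEpi_inc_tensor hc X X' _ _ fun j => by
    rw [tensorHom_comp_whiskerRight_assoc, ← inc_naturality, ← whiskerRight_comp_tensorHom,
      Category.assoc, inc_μ, inc_μ_assoc, ← inc_naturality, μ_natural_left_assoc]
  μ_natural_right {X Y} X' f := jointlyEpi_inc_tensor hc X' X _ _ fun j => by
    rw [tensorHom_comp_whiskerLeft_assoc, ← inc_naturality, ← whiskerLeft_comp_tensorHom,
      Category.assoc, inc_μ, inc_μ_assoc, ← inc_naturality, μ_natural_right_assoc]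
  associativity X Y Z := jointlyEpi_inc_tensor_tensor hc X Y Z _ _ fun j => by
    rw [tensorHom_comp_whiskerRight_assoc, inc_μ, MonoidalCategory.associator_naturality_assoc,
      tensorHom_comp_whiskerLeft_assoc, inc_μ, ← whiskerRight_comp_tensorHom,
      ← whiskerLeft_comp_tensorHom, Category.assoc, Category.assoc, inc_μ, inc_μ_assoc,
      ← inc_naturality, associativity_assoc]
  left_unitality X := (jointlyEpi_inc hc X).whiskerLeft (𝟙_ M) _ _ fun j => by
    rw [leftUnitor_naturality, left_unitality, colimitε_eq j, ← tensorHom_def'_assoc,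
      ← whiskerRight_comp_tensorHom, Category.assoc, Category.assoc, Category.assoc, inc_μ_assoc,
      ← inc_naturality]
  right_unitality X := (jointlyEpi_inc hc X).whiskerRight (𝟙_ M) _ _ fun j => by
    rw [rightUnitor_naturality, right_unitality, colimitε_eq j,
      ← MonoidalCategory.tensorHom_def_assoc,
      ← whiskerLeft_comp_tensorHom, Category.assoc, Category.assoc, Category.assoc, inc_μ_assoc,
      ← inc_naturality]
  braided X Y := jointlyEpi_inc_tensor hc X Y _ _ fun j => by
    rw [inc_μ_assoc, ← inc_naturality, BraidedCategory.braiding_naturality_assoc, inc_μ,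
      Functor.LaxBraided.braided_assoc]

/-- A sifted colimit of premonoids, computed pointwise. -/
@[reducible] def colimitObj : CoSegalPremonoid M where
  F := c.pt
  lax := colimitLaxBraided hc
  normal := by
    -- The inverse unit maps of the `K.obj j` form a cocone by `σ_unitInv`; the induced map inverts
    -- the unit of the colimit.
    refine ⟨(hc (𝟙_ _)).desc
      { pt := 𝟙_ M
        ι :=
          { app := fun j => unitInv (K.obj j)
            naturality := fun i j g =>
              (σ_unitInv (K.map g)).trans (Category.comp_id _).symm } }, ?_,
      (hc (𝟙_ _)).hom_ext fun j => ?_⟩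
    · refine (Category.assoc _ _ _).trans ?_
      refine (congrArg (ε (K.obj (Classical.arbitrary J)).F ≫ ·) ((hc (𝟙_ _)).fac _ _)).trans ?_
      exact ε_unitInv _
    · refine (Category.assoc _ _ _).symm.trans
        ((congrArg (· ≫ colimitε K c) ((hc (𝟙_ _)).fac _ _)).trans ?_)
      refine Eq.trans ?_ (Category.comp_id _).symm
      refine (congrArg (unitInv (K.obj j) ≫ ·) (colimitε_eq j)).trans ?_
      refine (Category.assoc _ _ _).symm.trans ?_
      exact (congrArg (· ≫ inc c j _) (unitInv_ε (K.obj j))).trans (Category.id_comp _)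
  e := colimitE K c
  weak_unit := (jointlyEpi_inc hc (op one)).whiskerLeft (𝟙_ M) _ _ fun j => by
    rw [colimitE_eq j, leftUnitor_naturality_assoc, ← tensorHom_def'_assoc,
      ← whiskerRight_comp_tensorHom]
    refine (Category.assoc _ _ _).trans ?_
    refine (congrArg ((K.obj j).e ▷ _ ≫ ·) (inc_μ hc j (op one) (op one))).trans ?_
    refine (Category.assoc _ _ _).symm.trans ?_
    refine (congrArg (· ≫ inc c j _) (K.obj j).weak_unit).trans ?_
    refine (Category.assoc _ _ _).trans ?_
    exact congrArg _ (inc_naturality j fold.op)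

/-- The cocone of a sifted colimit of premonoids. -/
def colimitCocone : Cocone K where
  pt := colimitObj hc
  ι :=
    { app := fun j =>
        { σ := c.ι.app j
          isMonoidal := ⟨(colimitε_eq j).symm, fun X Y => (inc_μ hc j X Y).symm⟩
          e_comp := (colimitE_eq j).symm }
      naturality := fun _ _ g => hom_ext (c.ι.naturality g) }

/-- The cocone of a sifted colimit of premonoids is a colimit cocone. -/
def isColimitColimitCocone : IsColimit (colimitCocone hc) :=
  have hc' : IsColimit c := evaluationJointlyReflectsColimits _ hc
  have hd (s : Cocone K) (j : J) (X : PhiEpiᵒᵖ) :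
      inc c j X ≫ (hc'.desc ((underlying M).mapCocone s)).app X = (Hom.σ (s.ι.app j)).app X :=
    congrArg (fun k => k.app X) (hc'.fac ((underlying M).mapCocone s) j)
  { desc := fun s =>
      { σ := hc'.desc ((underlying M).mapCocone s)
        isMonoidal :=
          { unit := by
              refine (Category.assoc _ _ _).trans ?_
              exact (congrArg _ (hd s _ _)).trans (s.ι.app _).isMonoidal.unit
            tensor := fun X Y => jointlyEpi_inc_tensor hc X Y _ _ fun j => by
              refine (inc_μ_assoc hc j X Y _).trans ?_
              refine (congrArg _ (hd s j _)).trans ?_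
              refine ((s.ι.app j).isMonoidal.tensor X Y).trans ?_
              refine Eq.trans ?_ (Category.assoc _ _ _)
              refine congrArg (· ≫ μ s.pt.F X Y) ?_
              refine Eq.trans ?_ (MonoidalCategory.tensorHom_comp_tensorHom _ _ _ _).symm
              exact congrArg₂ (· ⊗ₘ ·) (hd s j X).symm (hd s j Y).symm }
        e_comp := by
          refine (Category.assoc _ _ _).trans ?_
          exact (congrArg _ (hd s _ _)).trans (s.ι.app _).e_comp }
    fac := fun s j => hom_ext (hc'.fac _ j)
    uniq := fun s m hm => hom_ext (hc'.uniq ((underlying M).mapCocone s) (Hom.σ m) fun j =>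
      congrArg Hom.σ (hm j)) }

end

section

variable [HasColimitsOfShape J M]

instance : HasColimitsOfShape J (CoSegalPremonoid M) where
  has_colimit K := ⟨⟨_, isColimitColimitCocone fun X =>
    isColimitOfPreserves ((evaluation PhiEpiᵒᵖ M).obj X) (colimit.isColimit (K ⋙ underlying M))⟩⟩

instance : PreservesColimitsOfShape J (underlying M) where
  preservesColimit {K} := preservesColimit_of_preserves_colimit_cocone
    (isColimitColimitCocone fun X =>
      isColimitOfPreserves ((evaluation PhiEpiᵒᵖ M).obj X) (colimit.isColimit (K ⋙ underlying M)))
    (IsColimit.ofIsoColimit (colimit.isColimit (K ⋙ underlying M)) (Cocone.ext (Iso.refl _) fun _ =>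
      Category.comp_id _))

instance : PreservesColimitsOfShape J (forget M) :=
  inferInstanceAs (PreservesColimitsOfShape J
    (underlying M ⋙ (Functor.whiskeringLeft _ _ M).obj PhiEpi.nonempty.ι.op))

end

/-- Only the component at the empty set is forgotten. There, compatibility with the two invertible
unit maps forces it to be invertible; the inverse transformation is automatically monoidal. -/
instance : (forget M).ReflectsIsomorphisms where
  reflects {A B} f hf := by
    have h (X : PhiEpiᵒᵖ) : IsIso ((Hom.σ f).app X) := by
      by_cases hX : X.unop.n = 0
      · obtain ⟨⟨n⟩⟩ := X
        obtain rfl : n = 0 := hX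
        have h' : ε A.F ≫ (Hom.σ f).app (𝟙_ _) = ε B.F := f.isMonoidal.unit
        exact IsIso.of_isIso_fac_left h'
      · exact inferInstanceAs (IsIso (((forget M).map f).app (op ⟨X.unop, hX⟩)))
    have : IsIso (Hom.σ f) := NatIso.isIso_of_isIso_app _
    have : NatTrans.IsMonoidal (asIso (Hom.σ f)).hom := f.isMonoidal
    have he : B.e ≫ (asIso (Hom.σ f)).inv.app (op one) = A.e := by
      rw [← f.e_comp, Category.assoc]
      exact (congrArg (A.e ≫ ·) ((asIso (Hom.σ f)).hom_inv_id_app (op one))).trans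
        (Category.comp_id _)
    exact ⟨⟨(asIso (Hom.σ f)).inv, inferInstance, he⟩, hom_ext (asIso (Hom.σ f)).hom_inv_id,
      hom_ext (asIso (Hom.σ f)).inv_hom_id⟩

end

end CoSegalPremonoid

/-! ### Siftedness of the shape of reflexive coequalizers -/

namespace CategoryTheory.Limits.WalkingReflexivePair

/-- This is connectedness of the category of cospans from `X` and `Y`, phrased elementarily.
Composing with `left` moves any apex to `zero`, and the few cospans over `zero` are linked by
zigzags through cospans over `one`, using the common section. -/
theorem cospan_induction {X Y : WalkingReflexivePair}
    (P : ∀ j : WalkingReflexivePair, (X ⟶ j) → (Y ⟶ j) → Prop)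
    (hP : ∀ {i j : WalkingReflexivePair} (k : i ⟶ j) (a : X ⟶ i) (b : Y ⟶ i),
      P i a b ↔ P j (a ≫ k) (b ≫ k))
    {i j : WalkingReflexivePair} (a : X ⟶ i) (b : Y ⟶ i) (a' : X ⟶ j) (b' : Y ⟶ j)
    (h : P i a b) : P j a' b' := by
  wlog hi : i = zero generalizing i
  · obtain _ | _ := i
    · exact (hi rfl).elim
    · exact this (a ≫ Hom.left) (b ≫ Hom.left) ((hP Hom.left a b).1 h) rfl
  wlog hj : j = zero generalizing j
  · obtain _ | _ := j
    · exact (hj rfl).elim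
    · exact (hP Hom.left a' b').2 (this (a' ≫ Hom.left) (b' ≫ Hom.left) rfl)
  subst hi hj
  obtain _ | _ := X <;> obtain _ | _ := Y
  · obtain ⟨⟩ := a; obtain ⟨⟩ := b; obtain ⟨⟩ := a'; obtain ⟨⟩ := b'
    exact h
  · have e : P zero (𝟙 _) Hom.left ↔ P zero (𝟙 _) Hom.right :=
      (hP Hom.left Hom.reflexion (𝟙 one)).symm.trans (hP Hom.right Hom.reflexion (𝟙 one))
    obtain ⟨⟩ := a; obtain ⟨⟩ := a'
    rcases b with ⟨⟩ | ⟨⟩ <;> rcases b' with ⟨⟩ | ⟨⟩ <;> first | exact h | exact e.1 h | exact e.2 h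
  · have e : P zero Hom.left (𝟙 _) ↔ P zero Hom.right (𝟙 _) :=
      (hP Hom.left (𝟙 one) Hom.reflexion).symm.trans (hP Hom.right (𝟙 one) Hom.reflexion)
    obtain ⟨⟩ := b; obtain ⟨⟩ := b'
    rcases a with ⟨⟩ | ⟨⟩ <;> rcases a' with ⟨⟩ | ⟨⟩ <;> first | exact h | exact e.1 h | exact e.2 h
  · have e₁ : P zero Hom.left Hom.left ↔ P zero Hom.right Hom.right :=
      (hP Hom.left (𝟙 one) (𝟙 one)).symm.trans (hP Hom.right (𝟙 one) (𝟙 one))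
    have e₂ : P zero Hom.left Hom.left ↔ P zero Hom.right Hom.left :=
      (hP Hom.left (𝟙 one) Hom.leftCompReflexion).symm.trans
        (hP Hom.right (𝟙 one) Hom.leftCompReflexion)
    have e₃ : P zero Hom.left Hom.right ↔ P zero Hom.right Hom.right :=
      (hP Hom.left (𝟙 one) Hom.rightCompReflexion).symm.trans
        (hP Hom.right (𝟙 one) Hom.rightCompReflexion)
    rcases a with ⟨⟩ | ⟨⟩ <;> rcases b with ⟨⟩ | ⟨⟩ <;> rcases a' with ⟨⟩ | ⟨⟩ <;>
      rcases b' with ⟨⟩ | ⟨⟩ <;> tauto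

/-- The category that indexes reflexive coequalizers is sifted. -/
instance : IsSifted WalkingReflexivePair where
  out := by
    rintro ⟨X, Y⟩
    have k : ∀ X : WalkingReflexivePair, Nonempty (X ⟶ zero) := by
      rintro (_ | _)
      exacts [⟨𝟙 _⟩, ⟨Hom.left⟩]
    obtain ⟨⟨x⟩, ⟨y⟩⟩ := And.intro (k X) (k Y)
    refine IsConnected.of_induct
      (j₀ := StructuredArrow.mk (Y := zero) (T := Functor.diag _) (x, y)) fun p h₀ h => ?_
    rintro ⟨⟨⟨⟩⟩, j, ⟨a, b⟩⟩
    exact cospan_induction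
      (fun j a b => StructuredArrow.mk (Y := j) (T := Functor.diag _) (S := (X, Y)) (a, b) ∈ p)
      (fun k a b => h (StructuredArrow.homMk k)) x y a b h₀
  nonempty := ⟨zero⟩

end CategoryTheory.Limits.WalkingReflexivePair

/-! ### Crude monadicity and lifting of colimits -/

namespace CategoryTheory

universe v u₁ u₂

open Limits

variable {C : Type u₁} {D : Type u₂} [Category.{v} C] [Category.{v} D]

theorem preservesColimit_parallelPair_of_isReflexivePair (G : C ⥤ D)
    [PreservesColimitsOfShape WalkingReflexivePair G] {A B : C} (f g : A ⟶ B)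
    [IsReflexivePair f g] : PreservesColimit (parallelPair f g) G :=
  preservesColimit_of_iso_diagram G (inclusionWalkingReflexivePairOfIsReflexivePairIso f g)

variable {F : D ⥤ C} {U : C ⥤ D} (adj : F ⊣ U) [U.ReflectsIsomorphisms]
  [HasColimitsOfShape WalkingReflexivePair C] [PreservesColimitsOfShape WalkingReflexivePair U]

/-- A functor with a left adjoint that reflects isomorphisms, whose source has reflexive
coequalizers that it preserves, is monadic. -/
noncomputable abbrev monadicRightAdjointOfReflexive : MonadicRightAdjoint U :=
  haveI : HasReflexiveCoequalizers C := hasReflexiveCoequalizers_iff.1 inferInstance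
  haveI : Monad.PreservesColimitOfIsReflexivePair U :=
    ⟨fun _ _ _ _ _ => preservesColimit_parallelPair_of_isReflexivePair _ _ _⟩
  Monad.monadicOfHasPreservesReflexiveCoequalizersOfReflectsIsomorphisms adj

include adj in
/-- A category with a conservative right adjoint functor to a cocomplete category is cocomplete
when it has reflexive coequalizers and the functor preserves them. -/
theorem hasColimitsOfShape_of_reflexive (J : Type*) [Category J] [HasColimitsOfShape J D] :
    HasColimitsOfShape J C := by
  rw [hasColimitsOfShape_iff_isRightAdjoint_const]
  have : HasReflexiveCoequalizers C := hasReflexiveCoequalizers_iff.1 inferInstance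
  have := adj.isRightAdjoint
  have : (Functor.const J : D ⥤ J ⥤ D).IsRightAdjoint :=
    hasColimitsOfShape_iff_isRightAdjoint_const.1 inferInstance
  -- Postcomposition with `U` on `J`-diagrams is monadic too, so the adjoint lifting theorem applies
  -- to the square formed by the two constant-diagram functors, `U` and this postcomposition.
  let := monadicRightAdjointOfReflexive (adj.whiskerRight J)
  exact isRightAdjoint_square_lift_monadic (Functor.const J)
    ((Functor.whiskeringRight J C D).obj U) U (Functor.const J)
    (Functor.compConstIso J U)

end CategoryTheory

/-! ### Cocompleteness and local presentability of premonoids -/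

namespace CoSegalPremonoid

open PhiEpi Limits

variable {M : Type u} [Category.{w} M] [MonoidalCategory M] [SymmetricCategory M]
  [MonoidalClosed M]

omit [MonoidalClosed M] in
-- The component at the empty set is determined by compatibility with the unit maps, because the
-- unit map of the source is epi.
instance : (forget M).Faithful where
  map_injective {A B f g} h := by
    refine hom_ext (NatTrans.ext (funext fun X => ?_))
    by_cases hX : X.unop.n = 0
    · obtain ⟨⟨n⟩⟩ := X
      obtain rfl : n = 0 := hX
      exact (cancel_epi (Functor.LaxMonoidal.ε A.F)).1
        (f.isMonoidal.unit.trans g.isMonoidal.unit.symm)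
    · exact congrArg (fun k => NatTrans.app k (op ⟨X.unop, hX⟩)) h

/-- Premonoids form a cocomplete category. -/
theorem hasColimitsOfSize [HasColimitsOfSize.{w, w} M] [HasColimitsOfSize.{0, 0} M] :
    HasColimitsOfSize.{w, w} (CoSegalPremonoid M) where
  has_colimits_of_shape J _ := hasColimitsOfShape_of_reflexive (freeAdjunction M) J

/-- Premonoids form a locally presentable category: the free premonoids on the generators of the
base category at the nonempty sets are a strong generator of presentable objects. -/
theorem isCardinalLocallyPresentable [HasColimitsOfSize.{0, 0} M] (κ : Cardinal.{w})
    [Fact κ.IsRegular] [IsCardinalLocallyPresentable M κ] :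
    IsCardinalLocallyPresentable (CoSegalPremonoid M) κ := by
  have := hasColimitsOfSize (M := M)
  rw [IsCardinalLocallyPresentable.iff_exists_isStrongGenerator]
  obtain ⟨P, _, hP, hPκ⟩ :=
    (IsCardinalLocallyPresentable.iff_exists_isStrongGenerator M κ).1 inferInstance
  let ev (X : Posᵒᵖ) : CoSegalPremonoid M ⥤ M := forget M ⋙ (evaluation _ M).obj X
  let L (X : Posᵒᵖ) : M ⥤ CoSegalPremonoid M := evaluationLeftAdjoint M X ⋙ freePremonoid M
  let adj (X : Posᵒᵖ) : L X ⊣ ev X := (evaluationAdjunctionRight M X).comp (freeAdjunction M)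
  let G (k : Posᵒᵖ × P.FullSubcategory) : CoSegalPremonoid M := (L k.1).obj k.2.obj
  -- A `κ`-filtered category is filtered, hence sifted, so both `forget M` and evaluation preserve
  -- colimits of this shape.
  have hev (X : Posᵒᵖ) : (ev X).IsCardinalAccessible κ := ⟨fun J _ _ => by
    have : IsFiltered J := isFiltered_of_isCardinalFiltered J κ
    have : IsSifted J := IsFiltered.isSifted
    infer_instance⟩
  refine ⟨ObjectProperty.ofObj G, inferInstance, ?_, ?_⟩
  · rw [ObjectProperty.isStrongGenerator_iff]
    refine ⟨fun A B f g h => ?_, fun A B i hi h => ?_⟩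
    · apply (forget M).map_injective
      ext X
      -- Maps from `Q` into the value at `X` are transposed to maps out of the generator `(L X).obj
      -- Q`, where the hypothesis applies.
      refine hP.isSeparating _ _ fun Q hQ a => ((adj X).homEquiv Q B).symm.injective ?_
      have := h (G (X, ⟨Q, hQ⟩)) (ObjectProperty.ofObj_apply _ _) (((adj X).homEquiv Q A).symm a)
      rwa [← (adj X).homEquiv_naturality_right_symm,
        ← (adj X).homEquiv_naturality_right_symm] at this
    · have hev (X : Posᵒᵖ) : IsIso ((ev X).map i) := by
        -- A right adjoint preserves monomorphisms, so each component of `i` is mono and the strong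
        -- generator of `M` detects that it is invertible.
        have := (adj X).isRightAdjoint
        refine hP.isIso_of_mono _ fun Q hQ b => ?_
        obtain ⟨a, ha⟩ := h (G (X, ⟨Q, hQ⟩)) (ObjectProperty.ofObj_apply _ _) (((adj X).homEquiv Q B).symm b)
        refine ⟨(adj X).homEquiv Q A a, ?_⟩
        beta_reduce at ha ⊢
        rw [← (adj X).homEquiv_naturality_right, ha, Equiv.apply_symm_apply]
      have : IsIso ((forget M).map i) := by
        rw [NatTrans.isIso_iff_isIso_app]
        exact hev
      exact isIso_of_reflects_iso i (forget M)
  · rintro _ ⟨X, A⟩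
    have := hPκ _ A.property
    rw [isCardinalPresentable_iff] at this ⊢
    -- The left adjoint of an accessible functor preserves presentable objects.
    exact (adj X).isCardinalPresentable_leftAdjoint_obj κ A.obj

end CoSegalPremonoid

theorem theorem3p6 {M : Type u} [Category.{w} M] [MonoidalCategory M] [SymmetricCategory M]
    [MonoidalClosed M] [IsLocallyPresentable.{w} M] :
    (∃ (Γ : (PhiEpi.Posᵒᵖ ⥤ M) ⥤ CoSegalPremonoid M) (adj : Γ ⊣ CoSegalPremonoid.forget M),
      (Monad.comparison adj).IsEquivalence) ∧
    IsLocallyPresentable.{w} (CoSegalPremonoid M) := by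
  obtain ⟨κ, _, _⟩ := IsLocallyPresentable.exists_cardinal.{w} M
  -- Expressions and steps live in `Type`, so the free construction needs colimits of size zero,
  -- whatever `w` is.
  have : Limits.HasColimitsOfSize.{0, 0} M := Limits.hasColimitsOfSizeShrink.{0, 0, w, w} M
  refine ⟨⟨CoSegalPremonoid.freePremonoid M, CoSegalPremonoid.freeAdjunction M, ?_⟩,
    ⟨κ, inferInstance, CoSegalPremonoid.isCardinalLocallyPresentable κ⟩⟩
  exact (monadicRightAdjointOfReflexive (CoSegalPremonoid.freeAdjunction M)).eqv
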